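/- For every integer $d\ge 1$ there is a constant $c(d)>0$, depending only on $d$, such that every finite non-empty simple $d$-regular graph $G$ satisfies $$\frac{1}{|V(G)|}\log m_{\mathrm{perf}}(G)\;\le\;\frac{1}{2d}\log m_{\mathrm{perf}}(K_{d,d})-c(d)\cdot\delta_\circ(G,K_{d,d}).$$ Here $m_{\mathrm{perf}}(H)$ is the number of perfect matchings of $H$, with $\log 0=-\infty$, and $\delta_\circ$ is the sampling distance $$\delta_\circ(G,G')=\sum_{r=1}^{\infty}2^{-r}\,\|\rho_r(G)-\rho_r(G')\|_{TV},$$ where $\rho_r(H)$ is the law of the depth-$r$ ball around a uniformly random vertex $v$ of $H$ (the subgraph induced on the vertices at distance at most $r$ from $v$, rooted at $v$, up to rooted isomorphism), and $\|\mu-\nu\|_{TV}=\sup_A|\mu(A)-\nu(A)|$. -/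

import Mathlib

open scoped ENNReal

noncomputable section

namespace SamplingDistance

/-- A finite rooted graph, on a vertex set of the form `Fin n`. -/
structure RootedGraph where
  /-- the number of vertices -/
  size : ℕ
  /-- the graph -/
  graph : SimpleGraph (Fin size)
  /-- the root -/
  root : Fin size

/-- Two finite rooted graphs are identified when some graph isomorphism maps root to root. -/
instance RootedGraph.setoid : Setoid RootedGraph where
  r A B := ∃ φ : A.graph ≃g B.graph, φ A.root = B.root
  iseqv :=
    { refl := fun _ => ⟨SimpleGraph.Iso.refl, rfl⟩
      symm := by
        rintro A B ⟨φ, h⟩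
        exact ⟨φ.symm, by rw [← h]; exact φ.symm_apply_apply _⟩
      trans := by
        rintro A B C ⟨φ, h⟩ ⟨ψ, k⟩
        exact ⟨φ.trans ψ, by rw [← k, ← h]; rfl⟩ }

/-- Isomorphism classes of finite rooted graphs. -/
def RootedClass : Type := Quotient RootedGraph.setoid

/-- The isomorphism class of the finite graph `H` rooted at `w`. -/
def rootedClass {W : Type*} [Finite W] (H : SimpleGraph W) (w : W) : RootedClass :=
  Quotient.mk RootedGraph.setoid
    ⟨Nat.card W, H.map (Finite.equivFin W).toEmbedding, Finite.equivFin W w⟩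

/-- Two rooted graphs have the same class exactly when they are isomorphic as rooted graphs. -/
theorem rootedClass_eq_iff {W W' : Type*} [Finite W] [Finite W'] (H : SimpleGraph W)
    (H' : SimpleGraph W') (w : W) (w' : W') :
    rootedClass H w = rootedClass H' w' ↔ ∃ φ : H ≃g H', φ w = w' := by
  let e := SimpleGraph.Iso.map (Finite.equivFin W) H
  let e' := SimpleGraph.Iso.map (Finite.equivFin W') H'
  constructor
  · intro h
    obtain ⟨φ, hφ⟩ := Quotient.exact h
    refine ⟨(e.trans φ).trans e'.symm, ?_⟩
    change e'.symm (φ (e w)) = w'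
    have : φ (e w) = e' w' := hφ
    rw [this]
    exact e'.symm_apply_apply w'
  · rintro ⟨φ, rfl⟩
    refine Quotient.sound ⟨(e.symm.trans φ).trans e', ?_⟩
    change e' (φ (e.symm (e w))) = e' (φ w)
    congr 2
    exact e.symm_apply_apply w

/-- The set of vertices of `G` at distance at most `r` from `v`. -/
def closedBall {V : Type*} (G : SimpleGraph V) (r : ℕ) (v : V) : Set V :=
  {w | G.edist v w ≤ r}

/-- The root belongs to the ball. -/
theorem mem_closedBall_self {V : Type*} (G : SimpleGraph V) (r : ℕ) (v : V) :
    v ∈ closedBall G r v := by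
  simp [closedBall]

/-- The depth `r` ball around `v` in `G`, that is, the subgraph of `G` induced on the vertices at
distance at most `r` from `v`, rooted at `v` and taken up to rooted isomorphism. -/
def ballClass {V : Type*} [Finite V] (G : SimpleGraph V) (r : ℕ) (v : V) : RootedClass :=
  rootedClass (G.induce (closedBall G r v)) ⟨v, mem_closedBall_self G r v⟩

/-- The distribution `ρ_r(G)` of the depth `r` ball around a uniformly random vertex of `G`. -/
def ballLaw {V : Type*} [Fintype V] [Nonempty V] (G : SimpleGraph V) (r : ℕ) :
    PMF RootedClass :=
  (PMF.uniformOfFintype V).map (ballClass G r)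

/-- Total variation distance, the supremum over all events `A` of `|p(A) - q(A)|`. -/
def tvDist {α : Type*} (p q : PMF α) : ℝ :=
  ⨆ A : Set α, |(p.toOuterMeasure A).toReal - (q.toOuterMeasure A).toReal|

/-- The sampling distance `δ_∘(G, G') = ∑_{r ≥ 1} 2^{-r} ‖ρ_r(G) - ρ_r(G')‖_TV`. -/
def samplingDist {V V' : Type*} [Fintype V] [Nonempty V] [Fintype V'] [Nonempty V']
    (G : SimpleGraph V) (G' : SimpleGraph V') : ℝ :=
  ∑' r : ℕ, (1 / 2 : ℝ) ^ (r + 1) * tvDist (ballLaw G (r + 1)) (ballLaw G' (r + 1))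

/-- Each difference of probabilities lies between `0` and `1` in absolute value. -/
theorem abs_prob_sub_le_one {α : Type*} (p q : PMF α) (A : Set α) :
    |(p.toOuterMeasure A).toReal - (q.toOuterMeasure A).toReal| ≤ 1 := by
  have key : ∀ p : PMF α, (p.toOuterMeasure A).toReal ≤ 1 := fun p => by
    refine ENNReal.toReal_le_of_le_ofReal zero_le_one ?_
    rw [ENNReal.ofReal_one, PMF.toOuterMeasure_apply, ← p.tsum_coe]
    exact ENNReal.tsum_le_tsum fun a => Set.indicator_le_self _ _ a
  have hp := key p
  have hq := key q
  have hp0 : 0 ≤ (p.toOuterMeasure A).toReal := ENNReal.toReal_nonneg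
  have hq0 : 0 ≤ (q.toOuterMeasure A).toReal := ENNReal.toReal_nonneg
  rw [abs_le]
  constructor <;> linarith

/-- The supremum in the total variation distance is over a bounded set. -/
theorem bddAbove_tvDist {α : Type*} (p q : PMF α) : BddAbove (Set.range fun A : Set α =>
    |(p.toOuterMeasure A).toReal - (q.toOuterMeasure A).toReal|) := by
  refine ⟨1, ?_⟩
  rintro _ ⟨A, rfl⟩
  exact abs_prob_sub_le_one p q A

/-- The series defining the sampling distance converges. -/
theorem summable_samplingDist {V V' : Type*} [Fintype V] [Nonempty V] [Fintype V'] [Nonempty V']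
    (G : SimpleGraph V) (G' : SimpleGraph V') :
    Summable fun r : ℕ =>
      (1 / 2 : ℝ) ^ (r + 1) * tvDist (ballLaw G (r + 1)) (ballLaw G' (r + 1)) := by
  refine Summable.of_nonneg_of_le (fun r => ?_) (fun r => ?_)
    ((summable_nat_add_iff 1).2 summable_geometric_two)
  · exact mul_nonneg (by positivity) (Real.iSup_nonneg fun _ => abs_nonneg _)
  · exact mul_le_of_le_one_right (by positivity) (ciSup_le fun A => abs_prob_sub_le_one _ _ A)

end SamplingDistance

/-- The number of perfect matchings of `G`. -/
def numPerfectMatchings {V : Type*} (G : SimpleGraph V) : ℕ :=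
  Nat.card {M : G.Subgraph // M.IsPerfectMatching}

end

/-! Two superposed perfect matchings form alternating cycles and doubled edges. Orienting each cycle
by a canonical rule turns a pair of matchings injectively into a permutation moving every vertex
along an edge (`sq_numPerfectMatchings_le`), so m_perf(G)² is at most the permanent of the adjacency
matrix. Brègman's theorem bounds that permanent by (d!)^(n/d), and d! ≤ m_perf(K_{d,d}).

The stability term comes from Radhakrishnan's entropy proof of Brègman. The values of a uniform such
permutation σ are revealed in a random order of the vertices, and each is compared with a uniform
choice among the neighbours still available. Keeping every entropy loss turns the bound into the
identity `card_mul_log_card`. Suppose u and v share a neighbour but have different neighbourhoods.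
Revealing u then v, or v then u, compares the same joint law of (σ u, σ v) with two different
sequential uniform laws. It cannot equal both, so u and v together lose at least a constant
depending on d (`le_loss_pair`, `le_meanLoss_pair`).

Hence defect vertices cost a constant each on average (`log_card_perm_le`). A vertex that is not a
defect lies in a K_{d,d} component, so the density of defects bounds the sampling distance
(`samplingDist_le`). -/

noncomputable section

/-- A relation that holds along each step of a permutation holds along its cycles. -/
theorem Equiv.Perm.SameCycle.rel_of_step {V : Type*} {σ : Equiv.Perm V} {r : V → V → Prop}
    (hr : Equivalence r) (h : ∀ v, r v (σ v)) {x y : V} (hxy : σ.SameCycle x y) : r x y := by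
  obtain ⟨i, rfl⟩ := hxy
  induction i using Int.induction_on with
  | zero => exact hr.refl _
  | succ i ih =>
    refine hr.trans ih ?_
    rw [add_comm, zpow_add, zpow_one]
    exact h _
  | pred i ih =>
    refine hr.trans ih (hr.symm ?_)
    have := h ((σ ^ (-(i : ℤ) - 1)) x)
    rwa [← Equiv.Perm.mul_apply, ← zpow_one_add, add_sub_cancel] at this

/-! ### Canonical orientation of the alternating cycles of two involutions -/

namespace AlternatingPerm

variable {V : Type*}

/-- The orbit of a point under the group generated by two involutions. -/
def orbit (a b : Equiv.Perm V) (v : V) : Set V :=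
  {x | (b * a).SameCycle v x ∨ (b * a).SameCycle (a v) x}

variable {a b : Equiv.Perm V}

theorem mem_orbit_self (v : V) : v ∈ orbit a b v := Or.inl (.refl _ _)

theorem orbit_left (ha : ∀ v, a (a v) = v) (v : V) : orbit a b (a v) = orbit a b v := by
  ext x
  simp only [orbit, Set.mem_ofPred_eq, ha]
  exact or_comm

theorem orbit_mul (ha : ∀ v, a (a v) = v) (hb : ∀ v, b (b v) = v) (v : V) :
    orbit a b (b (a v)) = orbit a b v := by
  have h1 : (b * a).SameCycle v (b (a v)) := ⟨1, by simp⟩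
  have h2 : (b * a).SameCycle (a (b (a v))) (a v) := ⟨1, by simp [ha, hb]⟩
  ext x
  simp only [orbit, Set.mem_ofPred_eq]
  exact or_congr ⟨fun h => h1.trans h, fun h => h1.symm.trans h⟩
    ⟨fun h => h2.symm.trans h, fun h => h2.trans h⟩

theorem orbit_right (ha : ∀ v, a (a v) = v) (hb : ∀ v, b (b v) = v) (v : V) :
    orbit a b (b v) = orbit a b v := by
  have := orbit_mul ha hb (a v)
  rwa [ha, orbit_left ha] at this

/-- Conjugation by `a` inverts `b * a`. A power of `b * a` taking `v` to `a v` would therefore,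
halfway along, produce a fixed point of `a` (even exponent) or of `b` (odd exponent). -/
theorem not_sameCycle (ha : ∀ v, a (a v) = v) (hb : ∀ v, b (b v) = v) (ha' : ∀ v, a v ≠ v)
    (hb' : ∀ v, b v ≠ v) (v : V) : ¬ (b * a).SameCycle v (a v) := by
  rintro ⟨i, hi⟩
  have hainv : a⁻¹ = a := by
    ext x
    rw [Equiv.Perm.inv_eq_iff_eq, ha]
  have hbinv : b⁻¹ = b := by
    ext x
    rw [Equiv.Perm.inv_eq_iff_eq, hb]
  have hconj : ∀ j : ℤ, ∀ x, (((b * a) ^ j)⁻¹) (a x) = a (((b * a) ^ j) x) := by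
    intro j x
    have h1 : a * (b * a) * a⁻¹ = (b * a)⁻¹ := by
      rw [mul_inv_rev, hainv, hbinv]
      ext y
      simp [ha]
    have h2 : a * (b * a) ^ j * a⁻¹ = ((b * a) ^ j)⁻¹ := by
      rw [← conj_zpow, h1, inv_zpow]
    rw [← h2, hainv]
    simp [ha]
  rcases Int.even_or_odd' i with ⟨j, rfl | rfl⟩
  · refine ha' (((b * a) ^ j) v) ?_
    rw [← hconj, ← hi, two_mul, zpow_add, ← Equiv.Perm.mul_apply, ← mul_assoc, inv_mul_cancel,
      one_mul]
  · refine hb' (a (((b * a) ^ j) v)) ?_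
    have h := hconj j v
    rw [← hi, show 2 * j + 1 = j + (1 + j) by ring, zpow_add, zpow_add, ← Equiv.Perm.mul_apply,
      ← mul_assoc, inv_mul_cancel, one_mul, zpow_one] at h
    exact h

variable [Nonempty V]

/-- A choice of an element of every nonempty set. -/
def rep (s : Set V) : V := Classical.epsilon fun x => x ∈ s

theorem rep_mem {s : Set V} {x : V} (h : x ∈ s) : rep s ∈ s :=
  Classical.epsilon_spec (p := fun x => x ∈ s) ⟨x, h⟩

/-- One of the two colour classes of the alternating cycles of two involutions. -/
def even (a b : Equiv.Perm V) : Set V :=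
  {v | (b * a).SameCycle (rep (orbit a b v)) v}

/-- An orbit consists of two distinct `b * a`-cycles exchanged by `a`, and `even` selects the one
through `rep`. The representative depends only on the orbit as a set, hence is the same for `v` and
`a v`. -/
theorem left_mem_even_iff (ha : ∀ v, a (a v) = v) (hb : ∀ v, b (b v) = v)
    (ha' : ∀ v, a v ≠ v) (hb' : ∀ v, b v ≠ v) (v : V) : a v ∈ even a b ↔ v ∉ even a b := by
  have hr : rep (orbit a b v) ∈ orbit a b v := rep_mem (mem_orbit_self v)
  simp only [even, Set.mem_ofPred_eq, orbit_left ha]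
  constructor
  · intro h h'
    exact not_sameCycle ha hb ha' hb' v (h'.symm.trans h)
  · intro h
    rcases hr with hr | hr
    · exact absurd hr.symm h
    · exact hr.symm

theorem right_mem_even_iff (ha : ∀ v, a (a v) = v) (hb : ∀ v, b (b v) = v)
    (ha' : ∀ v, a v ≠ v) (hb' : ∀ v, b v ≠ v) (v : V) : b v ∈ even a b ↔ v ∉ even a b := by
  rw [← left_mem_even_iff ha hb ha' hb' v]
  simp only [even, Set.mem_ofPred_eq, orbit_left ha, orbit_right ha hb]
  have h : (b * a).SameCycle (a v) (b v) := ⟨1, by simp [ha]⟩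
  exact ⟨fun h' => h'.trans h.symm, fun h' => h'.trans h⟩

open Classical in
/-- The permutation that follows `a` on one colour class and `b` on the other. -/
def alt (ha : ∀ v, a (a v) = v) (hb : ∀ v, b (b v) = v)
    (ha' : ∀ v, a v ≠ v) (hb' : ∀ v, b v ≠ v) : Equiv.Perm V where
  toFun v := if v ∈ even a b then a v else b v
  invFun v := if v ∈ even a b then b v else a v
  left_inv v := by
    by_cases h : v ∈ even a b
    · simp [h, left_mem_even_iff ha hb ha' hb', ha]
    · simp [h, right_mem_even_iff ha hb ha' hb', hb]
  right_inv v := by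
    by_cases h : v ∈ even a b
    · simp [h, right_mem_even_iff ha hb ha' hb', hb]
    · simp [h, left_mem_even_iff ha hb ha' hb', ha]

section

variable (ha : ∀ v, a (a v) = v) (hb : ∀ v, b (b v) = v) (ha' : ∀ v, a v ≠ v)
  (hb' : ∀ v, b v ≠ v)

theorem alt_of_mem {v : V} (h : v ∈ even a b) : alt ha hb ha' hb' v = a v := by
  simp [alt, h]

theorem alt_of_notMem {v : V} (h : v ∉ even a b) : alt ha hb ha' hb' v = b v := by
  simp [alt, h]

theorem symm_alt_of_mem {v : V} (h : v ∈ even a b) : (alt ha hb ha' hb').symm v = b v := by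
  simp [alt, h]

theorem symm_alt_of_notMem {v : V} (h : v ∉ even a b) : (alt ha hb ha' hb').symm v = a v := by
  simp [alt, h]

theorem orbit_eq_cycle (v : V) : orbit a b v = {x | (alt ha hb ha' hb').SameCycle v x} := by
  set σ := alt ha hb ha' hb' with hσ
  have hsa : ∀ w, σ.SameCycle w (a w) := fun w => by
    by_cases h : w ∈ even a b
    · exact ⟨1, by simp [hσ, alt_of_mem, h]⟩
    · exact ⟨-1, by simp [hσ, symm_alt_of_notMem, h]⟩
  have hsb : ∀ w, σ.SameCycle w (b w) := fun w => by
    by_cases h : w ∈ even a b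
    · exact ⟨-1, by simp [hσ, symm_alt_of_mem, h]⟩
    · exact ⟨1, by simp [hσ, alt_of_notMem, h]⟩
  have hba : ∀ {x y}, (b * a).SameCycle x y → σ.SameCycle x y := fun h =>
    h.rel_of_step (Equiv.Perm.SameCycle.equivalence σ) fun w => (hsa w).trans (hsb _)
  ext x
  constructor
  · rintro (h | h)
    · exact hba h
    · exact (hsa v).trans (hba h)
  · intro h
    have : orbit a b v = orbit a b x := by
      refine Equiv.Perm.SameCycle.rel_of_step (σ := σ)
        (r := fun x y => orbit a b x = orbit a b y) ⟨fun _ => rfl, Eq.symm, Eq.trans⟩ ?_ h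
      intro w
      by_cases hw : w ∈ even a b
      · rw [hσ, alt_of_mem ha hb ha' hb' hw, orbit_left ha]
      · rw [hσ, alt_of_notMem ha hb ha' hb' hw, orbit_right ha hb]
    rw [this]
    exact mem_orbit_self x

/-- The colour class can be recovered from σ = `alt` alone: the orbits are the cycles of σ, and σ²
is `b * a` on the even class and its inverse off it, so both have the same cycles. -/
theorem even_eq : even a b =
    {v | (alt ha hb ha' hb' * alt ha hb ha' hb').SameCycle
      (rep {x | (alt ha hb ha' hb').SameCycle v x}) v} := by
  ext v
  simp only [even, Set.mem_ofPred_eq, ← orbit_eq_cycle ha hb ha' hb']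
  set σ := alt ha hb ha' hb' with hσ
  constructor <;> intro h
  · refine h.rel_of_step (Equiv.Perm.SameCycle.equivalence (σ * σ)) fun w => ?_
    by_cases hw : w ∈ even a b
    · refine ⟨1, ?_⟩
      have hw' : a w ∉ even a b := by simpa [left_mem_even_iff ha hb ha' hb'] using hw
      simp [hσ, alt_of_mem ha hb ha' hb' hw, alt_of_notMem ha hb ha' hb' hw']
    · refine ⟨-1, ?_⟩
      have hw' : a w ∈ even a b := by simpa [left_mem_even_iff ha hb ha' hb'] using hw
      simp [hσ, symm_alt_of_notMem ha hb ha' hb' hw, symm_alt_of_mem ha hb ha' hb' hw']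
  · refine h.rel_of_step (Equiv.Perm.SameCycle.equivalence (b * a)) fun w => ?_
    by_cases hw : w ∈ even a b
    · refine ⟨1, ?_⟩
      have hw' : a w ∉ even a b := by simpa [left_mem_even_iff ha hb ha' hb'] using hw
      simp [hσ, alt_of_mem ha hb ha' hb' hw, alt_of_notMem ha hb ha' hb' hw']
    · have hw' : b w ∈ even a b := by simpa [right_mem_even_iff ha hb ha' hb'] using hw
      refine Equiv.Perm.SameCycle.symm ⟨1, ?_⟩
      simp [hσ, alt_of_notMem ha hb ha' hb' hw, alt_of_mem ha hb ha' hb' hw', ha, hb]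

end

/-- Once the even class is known, `a` is σ on it and σ⁻¹ off it, and `b` is the reverse. -/
theorem alt_injective {a' b' : Equiv.Perm V} (ha : ∀ v, a (a v) = v) (hb : ∀ v, b (b v) = v)
    (hfa : ∀ v, a v ≠ v) (hfb : ∀ v, b v ≠ v) (ha' : ∀ v, a' (a' v) = v)
    (hb' : ∀ v, b' (b' v) = v) (hfa' : ∀ v, a' v ≠ v) (hfb' : ∀ v, b' v ≠ v)
    (h : alt ha hb hfa hfb = alt ha' hb' hfa' hfb') : a = a' ∧ b = b' := by
  have he : even a b = even a' b' := by
    rw [even_eq ha hb hfa hfb, even_eq ha' hb' hfa' hfb', h]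
  constructor <;> ext v <;> by_cases hv : v ∈ even a b
  · rw [← alt_of_mem ha hb hfa hfb hv, h, alt_of_mem _ _ _ _ (he ▸ hv)]
  · rw [← symm_alt_of_notMem ha hb hfa hfb hv, h, symm_alt_of_notMem _ _ _ _ (he ▸ hv)]
  · rw [← symm_alt_of_mem ha hb hfa hfb hv, h, symm_alt_of_mem _ _ _ _ (he ▸ hv)]
  · rw [← alt_of_notMem ha hb hfa hfb hv, h, alt_of_notMem _ _ _ _ (he ▸ hv)]

end AlternatingPerm

/-! ### Pairs of perfect matchings as permutations -/

namespace SimpleGraph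

variable {V : Type*} {G : SimpleGraph V}

/-- The partner of a vertex in a perfect matching. -/
def Subgraph.IsPerfectMatching.partner {M : G.Subgraph} (hM : M.IsPerfectMatching) (v : V) : V :=
  (hM.1 (hM.2 v)).choose

theorem Subgraph.IsPerfectMatching.adj_iff {M : G.Subgraph} (hM : M.IsPerfectMatching) {v w : V} :
    M.Adj v w ↔ hM.partner v = w := by
  have h := (hM.1 (hM.2 v)).choose_spec
  constructor
  · intro hw
    exact (h.2 w hw).symm
  · rintro rfl
    exact h.1

theorem Subgraph.IsPerfectMatching.partner_partner {M : G.Subgraph} (hM : M.IsPerfectMatching)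
    (v : V) : hM.partner (hM.partner v) = v :=
  hM.adj_iff.1 (hM.adj_iff.2 rfl).symm

theorem Subgraph.IsPerfectMatching.adj_partner {M : G.Subgraph} (hM : M.IsPerfectMatching)
    (v : V) : G.Adj v (hM.partner v) :=
  M.adj_sub (hM.adj_iff.2 rfl)

/-- A perfect matching as a permutation of the vertices. -/
def Subgraph.IsPerfectMatching.perm {M : G.Subgraph} (hM : M.IsPerfectMatching) :
    Equiv.Perm V where
  toFun := hM.partner
  invFun := hM.partner
  left_inv := hM.partner_partner
  right_inv := hM.partner_partner

theorem Subgraph.IsPerfectMatching.perm_perm {M : G.Subgraph} (hM : M.IsPerfectMatching)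
    (v : V) : hM.perm (hM.perm v) = v :=
  hM.partner_partner v

theorem Subgraph.IsPerfectMatching.adj_perm {M : G.Subgraph} (hM : M.IsPerfectMatching)
    (v : V) : G.Adj v (hM.perm v) :=
  hM.adj_partner v

theorem Subgraph.IsPerfectMatching.perm_injective {M M' : G.Subgraph} (hM : M.IsPerfectMatching)
    (hM' : M'.IsPerfectMatching) (h : hM.perm = hM'.perm) : M = M' := by
  refine Subgraph.ext ?_ ?_
  · ext v
    exact ⟨fun _ => hM'.2 v, fun _ => hM.2 v⟩
  · ext v w
    rw [hM.adj_iff, hM'.adj_iff]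
    exact iff_of_eq (congrArg (fun σ : Equiv.Perm V => σ v = w) h)

/-- The number of pairs of perfect matchings is at most the number of permutations which move
every vertex along an edge. -/
theorem sq_numPerfectMatchings_le [Finite V] [Nonempty V] (G : SimpleGraph V) :
    numPerfectMatchings G ^ 2 ≤ Nat.card {σ : Equiv.Perm V // ∀ v, G.Adj v (σ v)} := by
  rw [numPerfectMatchings, sq, ← Nat.card_prod]
  have hne : ∀ {M : G.Subgraph} (hM : M.IsPerfectMatching) (v : V), hM.perm v ≠ v :=
    fun hM v => (hM.adj_perm v).ne'
  let f : {M : G.Subgraph // M.IsPerfectMatching} × {M : G.Subgraph // M.IsPerfectMatching} →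
      {σ : Equiv.Perm V // ∀ v, G.Adj v (σ v)} := fun p =>
    ⟨AlternatingPerm.alt (a := p.1.2.perm) (b := p.2.2.perm) p.1.2.perm_perm
      p.2.2.perm_perm (hne p.1.2) (hne p.2.2), fun v => by
        by_cases h : v ∈ AlternatingPerm.even p.1.2.perm p.2.2.perm
        · rw [AlternatingPerm.alt_of_mem _ _ _ _ h]
          exact p.1.2.adj_perm v
        · rw [AlternatingPerm.alt_of_notMem _ _ _ _ h]
          exact p.2.2.adj_perm v⟩
  refine Nat.card_le_card_of_injective f ?_
  rintro ⟨⟨M, hM⟩, ⟨M', hM'⟩⟩ ⟨⟨K, hK⟩, ⟨K', hK'⟩⟩ h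
  obtain ⟨h1, h2⟩ := AlternatingPerm.alt_injective hM.perm_perm hM'.perm_perm (hne hM) (hne hM')
    hK.perm_perm hK'.perm_perm (hne hK) (hne hK') (congrArg Subtype.val h)
  obtain rfl := hM.perm_injective hK h1
  obtain rfl := hM'.perm_injective hK' h2
  rfl

end SimpleGraph

/-! ### Weights of predecessor sets in a random order -/

namespace OrderWeight
open Finset
open scoped Nat

/-- The Beta integral `∫ t ^ a (1 - t) ^ b` over the unit interval. -/
def W (a b : ℕ) : ℝ := (a ! * b ! : ℝ) / (a + b + 1)!

theorem W_pos (a b : ℕ) : 0 < W a b := by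
  unfold W; positivity

/-- Insert 1 = t + (1 - t) under the integral. -/
theorem W_split (a b : ℕ) : W a b = W (a + 1) b + W a (b + 1) := by
  unfold W
  rw [show a + 1 + b + 1 = a + b + 1 + 1 by ring, show a + (b + 1) + 1 = a + b + 1 + 1 by ring,
    Nat.factorial_succ (a + b + 1), Nat.factorial_succ a, Nat.factorial_succ b]
  have : ((a + b + 1)! : ℝ) ≠ 0 := by positivity
  push_cast
  field_simp
  ring

/-- With independent uniform arrival times, an element of `Y` comes before or after time t with
total weight t + (1 - t) = 1, so elements irrelevant to `f` can be summed out one by one. -/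
theorem sum_W_union {V : Type*} [DecidableEq V] (X Y : Finset V) (h : Disjoint X Y) (a b : ℕ)
    (f : Finset V → ℝ) :
    ∑ S ∈ (X ∪ Y).powerset, W (a + #S) (b + #((X ∪ Y) \ S)) * f (S ∩ X) =
      ∑ S ∈ X.powerset, W (a + #S) (b + #(X \ S)) * f S := by
  induction Y using Finset.induction_on with
  | empty =>
    rw [union_empty]
    refine sum_congr rfl fun S hS => ?_
    rw [inter_eq_left.2 (mem_powerset.1 hS)]
  | insert y Y hy ih =>
    rw [disjoint_insert_right] at h
    have hyX : y ∉ X ∪ Y := by simp [h.1, hy]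
    rw [union_insert, sum_powerset_insert hyX, ← ih h.2, ← sum_add_distrib]
    refine sum_congr rfl fun S hS => ?_
    have hyS : y ∉ S := fun h => hyX (mem_powerset.1 hS h)
    rw [insert_inter_of_notMem h.1, card_insert_of_notMem hyS, insert_sdiff_of_notMem _ hyS,
      card_insert_of_notMem (by simp [hyX]), insert_sdiff_insert, sdiff_insert_of_notMem hyX,
      ← add_mul,
      W_split (a + #S) (b + #((X ∪ Y) \ S))]
    ring_nf

theorem sum_W_powerset {V : Type*} [DecidableEq V] (Y : Finset V) (a b : ℕ) :
    ∑ S ∈ Y.powerset, W (a + #S) (b + #(Y \ S)) = W a b := by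
  simpa using sum_W_union ∅ Y (disjoint_empty_left _) a b fun _ => 1

variable {V : Type*} [Fintype V] [DecidableEq V]

/-- The probability that, in a uniformly random order, the predecessors of a given element outside
`S` form the set `S`. -/
def wt (S : Finset V) : ℝ := W #S (#Sᶜ - 1)

theorem wt_pos (S : Finset V) : 0 < wt S := W_pos _ _

theorem card_compl_sub_one {u : V} {S : Finset V} (hS : S ∈ (univ.erase u).powerset) :
    #Sᶜ - 1 = #(univ.erase u \ S) := by
  have hu : u ∈ Sᶜ := by
    rw [mem_compl]
    intro h
    simpa using mem_powerset.1 hS h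
  rw [← card_erase_of_mem hu]
  congr 1
  ext x
  simp

/-- The increments of a set function along a random order add up to the total increment. -/
theorem sum_wt_increment [Nonempty V] (F : Finset V → ℝ) :
    ∑ u, ∑ S ∈ (univ.erase u).powerset, wt S * (F (insert u S) - F S) = F univ - F ∅ := by
  -- `ψ u T` is the contribution of `u` to the coefficient of `F T`: positive when T = S ∪ {u},
  -- negative when T = S.
  let ψ : V → Finset V → ℝ := fun u T =>
    if u ∈ T then W (#T - 1) #Tᶜ * F T else -(W #T (#Tᶜ - 1) * F T)
  have h1 : ∀ u, ∑ S ∈ (univ.erase u).powerset, wt S * (F (insert u S) - F S) =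
      ∑ T : Finset V, ψ u T := by
    intro u
    have hu : u ∉ (univ.erase u : Finset V) := by simp
    rw [← powerset_univ, ← insert_erase (mem_univ u), sum_powerset_insert hu, ← sum_add_distrib,
      insert_erase (mem_univ u)]
    refine sum_congr rfl fun S hS => ?_
    have hS' : u ∉ S := fun h => hu (mem_powerset.1 hS h)
    simp only [ψ, hS', mem_insert_self, if_true, if_false, wt, card_insert_of_notMem hS',
      compl_insert, Nat.add_sub_cancel]
    rw [card_erase_of_mem (by simpa using hS')]
    ring
  have h2 : ∀ T : Finset V, ∑ u, ψ u T =
      (if T = univ then F univ else 0) - (if T = ∅ then F ∅ else 0) := by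
    intro T
    have : ∑ u, ψ u T = (#T * W (#T - 1) #Tᶜ - #Tᶜ * W #T (#Tᶜ - 1)) * F T := by
      simp only [ψ]
      rw [sum_ite, sum_const, sum_const, filter_mem_eq_inter, univ_inter]
      have : univ.filter (fun u => u ∉ T) = Tᶜ := by ext; simp
      rw [this]
      simp only [nsmul_eq_mul]
      ring
    rw [this]
    -- Both parts of the coefficient equal |T|! |Tᶜ|! / n! and cancel, except at `∅` and `univ`,
    -- where one part has the factor zero (so its truncated subtraction is harmless) and the other
    -- is 1.
    have hW1 : ∀ a b : ℕ, ((a + 1 : ℕ) : ℝ) * W a b = (a + 1)! * b ! / (a + b + 1)! := by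
      intro a b
      rw [W, Nat.factorial_succ a]
      push_cast
      ring
    have hW2 : ∀ a b : ℕ, ((b + 1 : ℕ) : ℝ) * W a b = a ! * (b + 1)! / (a + b + 1)! := by
      intro a b
      rw [W, Nat.factorial_succ b]
      push_cast
      ring
    have hn : 0 < Fintype.card V := Fintype.card_pos
    by_cases hT : T = ∅
    · subst hT
      have : (∅ : Finset V) ≠ univ := by
        rw [ne_comm, ← nonempty_iff_ne_empty]; exact univ_nonempty
      simp only [this, if_true, if_false, card_empty, compl_empty, card_univ]
      obtain ⟨m, hm⟩ := Nat.exists_eq_succ_of_ne_zero hn.ne'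
      rw [hm, Nat.succ_eq_add_one, Nat.add_sub_cancel, hW2]
      have : ((m + 1)! : ℝ) ≠ 0 := by positivity
      simp [this]
    · have hT0 : #T ≠ 0 := by simpa using hT
      obtain ⟨a, haT⟩ := Nat.exists_eq_succ_of_ne_zero hT0
      by_cases hT' : T = univ
      · have hc : #Tᶜ = 0 := by simp [hT']
        rw [haT, hc, Nat.succ_eq_add_one, Nat.add_sub_cancel, hW1]
        have : ((a + 1)! : ℝ) ≠ 0 := by positivity
        rw [if_pos hT', if_neg hT, hT']
        simp [this]
      · have hc : #Tᶜ ≠ 0 := by simpa using hT'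
        obtain ⟨b, hbT⟩ := Nat.exists_eq_succ_of_ne_zero hc
        rw [haT, hbT, Nat.succ_eq_add_one, Nat.succ_eq_add_one, Nat.add_sub_cancel,
          Nat.add_sub_cancel, hW1, hW2]
        simp only [hT, hT', if_false]
        rw [show a + 1 + b + 1 = a + (b + 1) + 1 by ring]
        ring
  simp_rw [h1]
  rw [sum_comm]
  simp_rw [h2]
  rw [sum_sub_distrib]
  simp

/-- In a random order, the rank of an element `u` of `D` from the end is uniform. -/
theorem sum_wt_card_sdiff (D : Finset V) {u : V} (hu : u ∈ D) (g : ℕ → ℝ) :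
    ∑ S ∈ (univ.erase u).powerset, wt S * g #(D \ S) = (∑ i ∈ range #D, g (i + 1)) / #D := by
  have hdisj : Disjoint (D.erase u) Dᶜ :=
    disjoint_of_subset_left (erase_subset _ _) disjoint_compl_right
  have hun : D.erase u ∪ Dᶜ = univ.erase u := by
    ext x
    by_cases hx : x ∈ D
    · simp [hx]
    · have : x ≠ u := fun h => hx (h ▸ hu)
      simp [hx, this]
  have key := sum_W_union (D.erase u) Dᶜ hdisj 0 0 fun S => g (1 + #(D.erase u \ S))
  rw [hun] at key
  simp only [zero_add] at key
  calc _ = _ := sum_congr rfl fun S hS => ?_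
    _ = _ := key
    _ = _ := ?_
  · have hS' : u ∉ S := fun h => by simpa using mem_powerset.1 hS h
    rw [wt, card_compl_sub_one hS]
    congr 2
    have : D \ S = insert u (D.erase u \ (S ∩ D.erase u)) := by
      ext x
      by_cases hx : x = u
      · simp [hx, hu, hS']
      · simp [hx]
    rw [this, card_insert_of_notMem (by simp), add_comm]
  · obtain ⟨m, hm⟩ := Nat.exists_eq_succ_of_ne_zero (card_pos.2 ⟨u, hu⟩).ne'
    have hm' : #(D.erase u) = m := by rw [card_erase_of_mem hu, hm]; rfl
    have : ∀ S ∈ (D.erase u).powerset, W #S #(D.erase u \ S) * g (1 + #(D.erase u \ S)) =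
        (fun j => W j (m - j) * g (1 + (m - j))) #S := by
      intro S hS
      rw [card_sdiff_of_subset (mem_powerset.1 hS), hm']
    rw [sum_congr rfl this, sum_powerset_apply_card (fun j => W j (m - j) * g (1 + (m - j))), hm', hm, Nat.succ_eq_add_one,
      ← sum_range_reflect (fun i => g (i + 1)), sum_div]
    refine sum_congr rfl fun j hj => ?_
    have hj' : j ≤ m := Nat.lt_succ_iff.1 (mem_range.1 hj)
    -- Each size `j` has total weight `choose m j * W j (m - j)` = 1 / (m + 1), which is the
    -- uniformity of the rank.
    rw [nsmul_eq_mul, show m + 1 - 1 - j + 1 = 1 + (m - j) by omega, ← mul_assoc, W,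
      show j + (m - j) + 1 = m + 1 by omega, Nat.cast_choose ℝ hj', Nat.factorial_succ m]
    have h1 : (j ! : ℝ) ≠ 0 := by positivity
    have h2 : ((m - j)! : ℝ) ≠ 0 := by positivity
    have h3 : (m ! : ℝ) ≠ 0 := by positivity
    push_cast
    field_simp

/-- The weight common to the pairs `(u, S)` and `(v, insert u S)`. -/
def wtMin (S : Finset V) : ℝ := W (#S + 1) (#Sᶜ - 1)

theorem wtMin_nonneg (S : Finset V) : 0 ≤ wtMin S := (W_pos _ _).le

/-- In integral form `wtMin` has the integrand of `wt S` times t; in `wtMin_le_insert` it is that of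
`wt (insert u S)` times 1 - t. -/
theorem wtMin_le (S : Finset V) : wtMin S ≤ wt S := by
  rw [wtMin, wt, W_split #S]
  linarith [W_pos #S (#Sᶜ - 1 + 1)]

theorem wtMin_le_insert {u v : V} (huv : u ≠ v) {S : Finset V} (hu : u ∉ S) (hv : v ∉ S) :
    wtMin S ≤ wt (insert u S) := by
  have h2 : 2 ≤ #Sᶜ := by
    rw [← card_pair huv]
    exact card_le_card (by simp [insert_subset_iff, hu, hv])
  obtain ⟨k, hk⟩ := Nat.exists_eq_add_of_le' h2
  rw [wtMin, wt, compl_insert, card_erase_of_mem (by simpa using hu), card_insert_of_notMem hu, hk,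
    show k + 2 - 1 = k + 1 by omega, Nat.add_sub_cancel, W_split _ k]
  linarith [W_pos (#S + 1 + 1) k]

/-- Summing out `Zᶜ` leaves W(1, z - 1) = 1 / (z (z + 1)) with z = |Z|, which is 1/20 at z = 4. -/
theorem le_sum_wtMin (Z : Finset V) (hZ : Z.Nonempty) (hZ4 : #Z ≤ 4) :
    1 / 20 ≤ ∑ S ∈ Zᶜ.powerset, wtMin S := by
  have hz : 0 < #Z := card_pos.2 hZ
  have : ∀ S ∈ Zᶜ.powerset, wtMin S = W (1 + #S) (#Z - 1 + #(Zᶜ \ S)) := by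
    intro S hS
    have hS' : S ⊆ Zᶜ := mem_powerset.1 hS
    have h1 := card_sdiff_of_subset hS'
    have h2 := card_le_card hS'
    have h3 := card_compl_add_card S
    have h4 := card_compl_add_card Z
    rw [wtMin, add_comm 1]
    congr 1
    omega
  rw [sum_congr rfl this, sum_W_powerset]
  generalize #Z = z at hz hZ4
  interval_cases z <;> norm_num [W, Nat.factorial]

end OrderWeight

/-! ### Conditional entropy and the loss of a revealing step -/

namespace PermEntropy
open Finset

/-- Summing over the values of `φ` on `F`. -/
theorem sum_div_card_fiber {α β : Type*} [DecidableEq β] (F : Finset α) (φ : α → β)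
    (g : β → ℝ) :
    ∑ x ∈ F, g (φ x) / #{y ∈ F | φ y = φ x} = ∑ b ∈ F.image φ, g b := by
  rw [sum_comp (fun b => g b / #{y ∈ F | φ y = b}) φ]
  refine sum_congr rfl fun b hb => ?_
  obtain ⟨x, hx, rfl⟩ := mem_image.1 hb
  have : (#{y ∈ F | φ y = φ x} : ℝ) ≠ 0 := by
    have : 0 < #{y ∈ F | φ y = φ x} := card_pos.2 ⟨x, by simp [hx]⟩
    positivity
  rw [nsmul_eq_mul]
  field_simp

theorem sum_inv_card_le {α : Type*} (A : Finset α) : ∑ _a ∈ A, (#A : ℝ)⁻¹ ≤ 1 := by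
  rw [sum_const, nsmul_eq_mul]
  exact mul_inv_le_one

variable {V : Type*} [DecidableEq V]

/-- The members of `P` that agree with `σ` on `S`. -/
def cyl (P : Finset (Equiv.Perm V)) (S : Finset V) (σ : Equiv.Perm V) :
    Finset (Equiv.Perm V) :=
  {τ ∈ P | ∀ x ∈ S, τ x = σ x}

variable {P : Finset (Equiv.Perm V)} {S : Finset V} {σ τ : Equiv.Perm V}

theorem mem_cyl : τ ∈ cyl P S σ ↔ τ ∈ P ∧ ∀ x ∈ S, τ x = σ x := by
  simp [cyl]

theorem self_mem_cyl (h : σ ∈ P) : σ ∈ cyl P S σ := mem_cyl.2 ⟨h, fun _ _ => rfl⟩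

theorem cyl_congr (h : τ ∈ cyl P S σ) : cyl P S τ = cyl P S σ := by
  ext ρ
  simp only [mem_cyl]
  refine and_congr_right fun _ => forall₂_congr fun x hx => ?_
  rw [(mem_cyl.1 h).2 x hx]

theorem card_cyl_pos (h : σ ∈ P) : (0 : ℝ) < #(cyl P S σ) :=
  Nat.cast_pos.2 (card_pos.2 ⟨σ, self_mem_cyl h⟩)

/-- The cylinders over `S` partition `P`, and averaging within the classes of a partition preserves
the sum. -/
theorem sum_cyl_average (P : Finset (Equiv.Perm V)) (S : Finset V) (X : Equiv.Perm V → ℝ) :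
    ∑ σ ∈ P, (∑ τ ∈ cyl P S σ, X τ) / #(cyl P S σ) = ∑ σ ∈ P, X σ := by
  classical
  have h1 : ∀ σ ∈ P, (∑ τ ∈ cyl P S σ, X τ) / #(cyl P S σ) =
      ∑ τ ∈ P, if τ ∈ cyl P S σ then X τ / #(cyl P S τ) else 0 := by
    intro σ hσ
    rw [← sum_filter, sum_div]
    have : P.filter (fun τ => τ ∈ cyl P S σ) = cyl P S σ := by
      ext τ
      simp only [mem_filter, mem_cyl]
      tauto
    rw [this]
    exact sum_congr rfl fun τ hτ => by rw [cyl_congr hτ]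
  rw [sum_congr rfl h1, sum_comm]
  refine sum_congr rfl fun τ hτ => ?_
  rw [← sum_filter, sum_const]
  have : P.filter (fun σ => τ ∈ cyl P S σ) = cyl P S τ := by
    ext σ
    simp only [mem_filter, mem_cyl]
    exact ⟨fun h => ⟨h.1, fun x hx => (h.2.2 x hx).symm⟩,
      fun h => ⟨h.1, hτ, fun x hx => (h.2 x hx).symm⟩⟩
  rw [this, nsmul_eq_mul]
  have := (card_cyl_pos (S := S) hτ).ne'
  field_simp

/-- Gibbs' inequality for the conditional law of `φ` given the values on `S`, compared with a
defective conditional law `q`. -/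
theorem gibbs {β : Type*} [DecidableEq β] (P : Finset (Equiv.Perm V)) (S : Finset V)
    (φ : Equiv.Perm V → β) (q : Equiv.Perm V → β → ℝ) (ε : Equiv.Perm V → ℝ)
    (hpos : ∀ σ ∈ P, 0 < q σ (φ σ)) (hq : ∀ σ ∈ P, ∀ τ ∈ cyl P S σ, q τ = q σ)
    (hsum : ∀ σ ∈ P, ∑ y ∈ (cyl P S σ).image φ, q σ y ≤ 1 - ε σ) :
    ∑ σ ∈ P, ε σ ≤ ∑ σ ∈ P, (Real.log #{τ ∈ cyl P S σ | φ τ = φ σ}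
      - Real.log #(cyl P S σ) - Real.log (q σ (φ σ))) := by
  -- `X σ` is the ratio of `q` to the true conditional probability of `φ σ`. Its average over a
  -- cylinder is the `q`-mass of the attained values, and log X ≤ X - 1 does the rest.
  let X : Equiv.Perm V → ℝ := fun σ =>
    q σ (φ σ) * #(cyl P S σ) / #{τ ∈ cyl P S σ | φ τ = φ σ}
  have hp : ∀ σ ∈ P, (0 : ℝ) < #{τ ∈ cyl P S σ | φ τ = φ σ} := fun σ hσ =>
    Nat.cast_pos.2 (card_pos.2 ⟨σ, by simp [self_mem_cyl hσ]⟩)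
  have hX : ∑ σ ∈ P, X σ ≤ ∑ σ ∈ P, (1 - ε σ) := by
    rw [← sum_cyl_average P S X]
    refine sum_le_sum fun σ hσ => ?_
    refine le_trans (le_of_eq ?_) (hsum σ hσ)
    rw [← sum_div_card_fiber, sum_div]
    refine sum_congr rfl fun τ hτ => ?_
    have := (card_cyl_pos (S := S) hσ).ne'
    simp only [X]
    rw [cyl_congr hτ, hq σ hσ τ hτ]
    field_simp
  have h1 : ∀ σ ∈ P, 1 - X σ ≤ Real.log #{τ ∈ cyl P S σ | φ τ = φ σ}
      - Real.log #(cyl P S σ) - Real.log (q σ (φ σ)) := by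
    intro σ hσ
    have hK := card_cyl_pos (S := S) hσ
    have hXpos : 0 < X σ := div_pos (mul_pos (hpos σ hσ) hK) (hp σ hσ)
    have := Real.log_le_sub_one_of_pos hXpos
    simp only [X] at this ⊢
    rw [Real.log_div (mul_pos (hpos σ hσ) hK).ne' (hp σ hσ).ne',
      Real.log_mul (hpos σ hσ).ne' hK.ne'] at this
    linarith
  calc ∑ σ ∈ P, ε σ = ∑ σ ∈ P, 1 - ∑ σ ∈ P, (1 - ε σ) := by
        rw [← sum_sub_distrib]; simp
    _ ≤ ∑ σ ∈ P, 1 - ∑ σ ∈ P, X σ := by linarith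
    _ = ∑ σ ∈ P, (1 - X σ) := by rw [sum_sub_distrib]
    _ ≤ _ := sum_le_sum h1

/-- The probability of each pair `(a, b)` when `a` is uniform on `A` and then `b` is uniform on
`B.erase a`. -/
def seqUnif (A B : Finset V) (a : V) : ℝ := ((#A : ℝ) * #(B.erase a))⁻¹

theorem seqUnif_nonneg (A B : Finset V) (a : V) : 0 ≤ seqUnif A B a := by
  unfold seqUnif; positivity

theorem seqUnif_le_one (A B : Finset V) (a : V) : seqUnif A B a ≤ 1 := by
  unfold seqUnif
  rw [← Nat.cast_mul]
  exact Nat.cast_inv_le_one _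

theorem sum_seqUnif_le (A B : Finset V) :
    ∑ p ∈ (A ×ˢ B).filter (fun p => p.1 ≠ p.2), seqUnif A B p.1 ≤ 1 := by
  rw [sum_filter, sum_product]
  refine le_trans (sum_le_sum fun a _ => ?_) (sum_inv_card_le A)
  rw [← sum_filter]
  have : B.filter (fun b => a ≠ b) = B.erase a := by
    ext b
    simp [and_comm, eq_comm]
  rw [this]
  simp only [seqUnif, mul_inv]
  rw [← mul_sum]
  exact mul_le_of_le_one_right (by positivity) (sum_inv_card_le _)

theorem sum_seqUnif_swap_le (A B : Finset V) :
    ∑ p ∈ (A ×ˢ B).filter (fun p => p.1 ≠ p.2), seqUnif B A p.2 ≤ 1 := by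
  refine le_trans (le_of_eq ?_) (sum_seqUnif_le B A)
  refine sum_nbij' Prod.swap Prod.swap ?_ ?_ ?_ ?_ ?_ <;> simp +contextual [eq_comm]

/-- The gap in the AM-GM inequality is (√x - √y)² / 2, and (x - y)² = (√x + √y)² (√x - √y)² ≤ 4 (√x
- √y)². -/
theorem sqrt_mul_le_sub {x y : ℝ} (hx : 0 ≤ x) (hy : 0 ≤ y) (hx1 : x ≤ 1) (hy1 : y ≤ 1) :
    √(x * y) ≤ (x + y) / 2 - (x - y) ^ 2 / 8 := by
  rw [Real.sqrt_mul hx]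
  have h1 := Real.sq_sqrt hx
  have h2 := Real.sq_sqrt hy
  have h3 : √x ≤ 1 := Real.sqrt_le_one.2 hx1
  have h4 : √y ≤ 1 := Real.sqrt_le_one.2 hy1
  have h5 := Real.sqrt_nonneg x
  have h6 := Real.sqrt_nonneg y
  generalize √x = s at *
  generalize √y = t at *
  subst h1 h2
  have h7 : (s + t) ^ 2 ≤ 4 := by nlinarith
  have h8 : (s ^ 2 - t ^ 2) ^ 2 ≤ 4 * (s - t) ^ 2 := by
    have : (s ^ 2 - t ^ 2) ^ 2 = (s + t) ^ 2 * (s - t) ^ 2 := by ring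
    rw [this]
    exact mul_le_mul_of_nonneg_right h7 (sq_nonneg _)
  nlinarith

/-- The affinity of the two sequential uniform laws on `A × B`. -/
theorem sum_sqrt_seqUnif_le (A B : Finset V) (T : Finset (V × V))
    (hT : T ⊆ (A ×ˢ B).filter (fun p => p.1 ≠ p.2)) :
    ∑ p ∈ T, √(seqUnif A B p.1 * seqUnif B A p.2) ≤ 1 := by
  have h1 := sum_seqUnif_le A B
  have h2 := sum_seqUnif_swap_le A B
  calc _ ≤ ∑ p ∈ (A ×ˢ B).filter (fun p => p.1 ≠ p.2),
        √(seqUnif A B p.1 * seqUnif B A p.2) :=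
        sum_le_sum_of_subset_of_nonneg hT fun _ _ _ => Real.sqrt_nonneg _
    _ ≤ ∑ p ∈ (A ×ˢ B).filter (fun p => p.1 ≠ p.2),
        (seqUnif A B p.1 + seqUnif B A p.2) / 2 := by
        refine sum_le_sum fun p _ => ?_
        have := sqrt_mul_le_sub (seqUnif_nonneg A B p.1) (seqUnif_nonneg B A p.2)
          (seqUnif_le_one _ _ _) (seqUnif_le_one _ _ _)
        nlinarith [sq_nonneg (seqUnif A B p.1 - seqUnif B A p.2)]
    _ ≤ 1 := by
        rw [← sum_div, sum_add_distrib]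
        linarith

/-- The two laws disagree at `(a, b)`: drawing `a` first gives 1 / (|A| |B|), since removing `a`
does not shrink `B`, while drawing `b` first gives 1 / (|B| (|A| - 1)). The difference is at least
d⁻³, and `sqrt_mul_le_sub` turns it into the deficit d⁻⁶ / 8. -/
theorem sum_sqrt_seqUnif_le_sub (A B : Finset V) (T : Finset (V × V))
    (hT : T ⊆ (A ×ˢ B).filter (fun p => p.1 ≠ p.2)) {d : ℕ} (hA : #A ≤ d) (hB : #B ≤ d)
    {a b : V} (haA : a ∈ A) (haB : a ∉ B) (hbA : b ∈ A) (hbB : b ∈ B) :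
    ∑ p ∈ T, √(seqUnif A B p.1 * seqUnif B A p.2) ≤ 1 - 1 / (8 * d ^ 6) := by
  have h1 := sum_seqUnif_le A B
  have h2 := sum_seqUnif_swap_le A B
  have hab : a ≠ b := fun h => haB (h ▸ hbB)
  have hmem : (a, b) ∈ (A ×ˢ B).filter (fun p => p.1 ≠ p.2) := by simp [haA, hbB, hab]
  have hgap : 1 / (8 * (d : ℝ) ^ 6) ≤ (seqUnif A B a - seqUnif B A b) ^ 2 / 8 := by
    obtain ⟨x, hx⟩ : ∃ x, #A = x + 1 + 1 := by
      have : 2 ≤ #A := by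
        rw [← card_pair hab]
        exact card_le_card (by simp [insert_subset_iff, haA, hbA])
      exact ⟨#A - 2, by omega⟩
    obtain ⟨y, hy⟩ : ∃ y, #B = y + 1 :=
      ⟨#B - 1, by have := card_pos.2 ⟨b, hbB⟩; omega⟩
    have hd : ((x : ℝ) + 1 + 1) ≤ d := by exact_mod_cast hx ▸ hA
    have hd' : ((y : ℝ) + 1) ≤ d := by exact_mod_cast hy ▸ hB
    have hx0 : (0 : ℝ) ≤ x := x.cast_nonneg
    have hy0 : (0 : ℝ) ≤ y := y.cast_nonneg
    have hval : (seqUnif A B a - seqUnif B A b) ^ 2 =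
        1 / (((x : ℝ) + 1 + 1) * (x + 1) * (y + 1)) ^ 2 := by
      rw [seqUnif, seqUnif, erase_eq_of_notMem haB, card_erase_of_mem hbA, hx, hy,
        Nat.add_sub_cancel]
      push_cast
      field_simp
      ring
    rw [hval, div_div]
    refine one_div_le_one_div_of_le (by positivity) ?_
    have hprod : ((x : ℝ) + 1 + 1) * (x + 1) * (y + 1) ≤ d ^ 3 := by
      have e1 : ((x : ℝ) + 1 + 1) * (x + 1) ≤ d * d :=
        mul_le_mul hd (by linarith) (by positivity) (by positivity)
      calc _ ≤ (d * d : ℝ) * d := mul_le_mul e1 hd' (by positivity) (by positivity)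
        _ = d ^ 3 := by ring
    have := pow_le_pow_left₀ (by positivity) hprod 2
    calc _ = 8 * (((x : ℝ) + 1 + 1) * (x + 1) * (y + 1)) ^ 2 := by ring
      _ ≤ 8 * ((d : ℝ) ^ 3) ^ 2 := by linarith
      _ = _ := by ring
  calc _ ≤ ∑ p ∈ (A ×ˢ B).filter (fun p => p.1 ≠ p.2),
        √(seqUnif A B p.1 * seqUnif B A p.2) :=
        sum_le_sum_of_subset_of_nonneg hT fun _ _ _ => Real.sqrt_nonneg _
    _ ≤ ∑ p ∈ (A ×ˢ B).filter (fun p => p.1 ≠ p.2),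
        ((seqUnif A B p.1 + seqUnif B A p.2) / 2 -
          if p = (a, b) then 1 / (8 * (d : ℝ) ^ 6) else 0) := by
        refine sum_le_sum fun p _ => ?_
        have := sqrt_mul_le_sub (seqUnif_nonneg A B p.1) (seqUnif_nonneg B A p.2)
          (seqUnif_le_one _ _ _) (seqUnif_le_one _ _ _)
        split_ifs with hp
        · subst hp
          simp only at this ⊢
          linarith
        · nlinarith [sq_nonneg (seqUnif A B p.1 - seqUnif B A p.2)]
    _ ≤ _ := by
        rw [sum_sub_distrib, ← sum_div, sum_add_distrib, sum_ite_eq' , if_pos hmem]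
        linarith

/-- The elements of `N` not yet used by `σ` on `S`. -/
def avail (N S : Finset V) (σ : Equiv.Perm V) : Finset V := N \ S.image σ

theorem avail_congr {N : Finset V} (h : τ ∈ cyl P S σ) : avail N S τ = avail N S σ := by
  have : S.image τ = S.image σ := image_congr fun x hx => (mem_cyl.1 h).2 x hx
  rw [avail, avail, this]

theorem apply_mem_avail {N : Finset V} {u : V} (hu : u ∉ S) (h : σ u ∈ N) :
    σ u ∈ avail N S σ := by
  simp [avail, h, hu]

theorem avail_insert (N S : Finset V) (u : V) (σ : Equiv.Perm V) :
    avail N (insert u S) σ = (avail N S σ).erase (σ u) := by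
  ext x
  simp only [avail, image_insert, mem_sdiff, mem_insert, mem_erase]
  tauto

theorem card_avail (N S : Finset V) (σ : Equiv.Perm V) :
    #(avail N S σ) = #(N.image σ.symm \ S) := by
  rw [← card_image_of_injective _ σ.symm.injective, avail, image_sdiff _ _ σ.symm.injective,
    image_image]
  simp

theorem cyl_insert (P : Finset (Equiv.Perm V)) (S : Finset V) (u : V) (σ : Equiv.Perm V) :
    cyl P (insert u S) σ = {τ ∈ cyl P S σ | τ u = σ u} := by
  ext τ
  simp only [mem_cyl, mem_filter, mem_insert, forall_eq_or_imp]
  tauto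

/-- The entropy lost when the value at `u` is revealed after those on `S`, compared with a uniform
choice among the available values, times the size of `P`. -/
def loss (P : Finset (Equiv.Perm V)) (N : V → Finset V) (u : V) (S : Finset V) : ℝ :=
  ∑ σ ∈ P, (Real.log #(avail (N u) S σ) + Real.log #(cyl P (insert u S) σ)
    - Real.log #(cyl P S σ))

variable {N : V → Finset V}

/-- Gibbs' inequality against the uniform law on the available values. -/
theorem loss_nonneg (hP : ∀ σ ∈ P, ∀ v, σ v ∈ N v) {u : V} (hu : u ∉ S) :
    0 ≤ loss P N u S := by
  have hpos : ∀ σ ∈ P, 0 < ((#(avail (N u) S σ) : ℝ))⁻¹ := fun σ hσ =>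
    inv_pos.2 (Nat.cast_pos.2 (card_pos.2 ⟨_, apply_mem_avail hu (hP σ hσ u)⟩))
  have := gibbs P S (fun σ => σ u) (fun σ _ => ((#(avail (N u) S σ) : ℝ))⁻¹) (fun _ => 0)
    hpos (fun σ _ τ hτ => by simp only [avail_congr hτ]) (fun σ hσ => by
      rw [sub_zero]
      refine le_trans (sum_le_sum_of_subset_of_nonneg ?_ fun _ _ _ => by positivity)
        (sum_inv_card_le (avail (N u) S σ))
      intro a ha
      obtain ⟨τ, hτ, rfl⟩ := mem_image.1 ha
      rw [← avail_congr hτ]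
      exact apply_mem_avail hu (hP τ (mem_cyl.1 hτ).1 u))
  rw [sum_const_zero] at this
  refine this.trans (le_of_eq (sum_congr rfl fun σ _ => ?_))
  rw [Real.log_inv, cyl_insert]
  ring

/-- Revealing two values in both orders loses entropy when the sets of available values overlap but
differ. -/
theorem le_loss_pair (hP : ∀ σ ∈ P, ∀ v, σ v ∈ N v) {d : ℕ} (hN : ∀ v, #(N v) ≤ d) {u v : V}
    (huv : u ≠ v) (hu : u ∉ S) (hv : v ∉ S) {w w' : V} (hwu : w ∈ N u) (hwv : w ∈ N v)
    (hwu' : w' ∈ N u) (hwv' : w' ∉ N v) :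
    #(P.filter fun σ : Equiv.Perm V => w ∉ S.image σ ∧ w' ∉ S.image σ) * (1 / (4 * d ^ 6) : ℝ) ≤
      loss P N u S + loss P N v (insert u S) + (loss P N v S + loss P N u (insert v S)) := by
  -- The geometric mean of the uniform laws for the two revealing orders: its logarithm averages
  -- theirs, so Gibbs' inequality against `q` bounds half the sum of the four losses. Its mass is
  -- the affinity of the two laws, below 1 when `w` and `w'` are both unused.
  let q : Equiv.Perm V → V × V → ℝ := fun σ p =>
    √(seqUnif (avail (N u) S σ) (avail (N v) S σ) p.1 *
      seqUnif (avail (N v) S σ) (avail (N u) S σ) p.2)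
  have hpos : ∀ σ ∈ P, 0 < #(avail (N u) S σ) ∧ 0 < #(avail (N v) S σ) ∧
      0 < #((avail (N v) S σ).erase (σ u)) ∧ 0 < #((avail (N u) S σ).erase (σ v)) := by
    intro σ hσ
    have h1 := apply_mem_avail hu (hP σ hσ u)
    have h2 := apply_mem_avail hv (hP σ hσ v)
    have h3 : σ u ≠ σ v := fun h => huv (σ.injective h)
    exact ⟨card_pos.2 ⟨_, h1⟩, card_pos.2 ⟨_, h2⟩,
      card_pos.2 ⟨σ v, mem_erase.2 ⟨h3.symm, h2⟩⟩, card_pos.2 ⟨σ u, mem_erase.2 ⟨h3, h1⟩⟩⟩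
  have hmain := gibbs P S (fun σ => (σ u, σ v)) q
    (fun σ => if w ∉ S.image σ ∧ w' ∉ S.image σ then 1 / (8 * (d : ℝ) ^ 6) else 0)
    (fun σ hσ => by
      obtain ⟨h1, h2, h3, h4⟩ := hpos σ hσ
      simp only [q, seqUnif]
      positivity)
    (fun σ _ τ hτ => by simp only [q, avail_congr hτ])
    (fun σ hσ => by
      have hT : (cyl P S σ).image (fun σ => (σ u, σ v)) ⊆
          (avail (N u) S σ ×ˢ avail (N v) S σ).filter (fun p => p.1 ≠ p.2) := by
        intro p hp
        obtain ⟨τ, hτ, rfl⟩ := mem_image.1 hp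
        rw [← avail_congr hτ, ← avail_congr hτ, mem_filter, mem_product]
        have hτP := (mem_cyl.1 hτ).1
        exact ⟨⟨apply_mem_avail hu (hP τ hτP u), apply_mem_avail hv (hP τ hτP v)⟩,
          fun h => huv (τ.injective h)⟩
      split_ifs with hw
      · refine sum_sqrt_seqUnif_le_sub _ _ _ hT ((card_le_card sdiff_subset).trans (hN u))
          ((card_le_card sdiff_subset).trans (hN v)) (a := w') (b := w) ?_ ?_ ?_ ?_
        · exact mem_sdiff.2 ⟨hwu', hw.2⟩
        · exact fun h => hwv' (mem_sdiff.1 h).1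
        · exact mem_sdiff.2 ⟨hwu, hw.1⟩
        · exact mem_sdiff.2 ⟨hwv, hw.1⟩
      · rw [sub_zero]
        exact sum_sqrt_seqUnif_le _ _ _ hT)
  rw [← sum_filter, sum_const, nsmul_eq_mul] at hmain
  have hmain2 := mul_le_mul_of_nonneg_left hmain zero_le_two
  refine (le_of_eq ?_).trans (hmain2.trans (le_of_eq ?_))
  · ring
  · simp only [loss]
    rw [← sum_add_distrib, ← sum_add_distrib, ← sum_add_distrib, mul_sum]
    refine sum_congr rfl fun σ hσ => ?_
    obtain ⟨h1, h2, h3, h4⟩ := hpos σ hσ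
    have h1' : (#(avail (N u) S σ) : ℝ) ≠ 0 := by positivity
    have h2' : (#(avail (N v) S σ) : ℝ) ≠ 0 := by positivity
    have h3' : (#((avail (N v) S σ).erase (σ u)) : ℝ) ≠ 0 := by positivity
    have h4' : (#((avail (N u) S σ).erase (σ v)) : ℝ) ≠ 0 := by positivity
    have hc : ({τ ∈ cyl P S σ | (τ u, τ v) = (σ u, σ v)} : Finset _) =
        cyl P (insert v (insert u S)) σ := by
      rw [cyl_insert, cyl_insert, filter_filter]
      exact filter_congr fun τ _ => Prod.mk.injEq _ _ _ _ ▸ Iff.rfl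
    have hq : Real.log (q σ (σ u, σ v)) =
        -(Real.log #(avail (N u) S σ) + Real.log #((avail (N v) S σ).erase (σ u)) +
          (Real.log #(avail (N v) S σ) + Real.log #((avail (N u) S σ).erase (σ v)))) / 2 := by
      simp only [q, seqUnif]
      rw [Real.log_sqrt (by positivity), ← mul_inv, Real.log_inv,
        Real.log_mul (mul_ne_zero h1' h3') (mul_ne_zero h2' h4'), Real.log_mul h1' h3',
        Real.log_mul h2' h4']
    rw [hc, hq, avail_insert, avail_insert, insert_comm u v S]
    ring

end PermEntropy

/-! ### Averaging the losses over a random order -/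

namespace PermEntropy
open Finset OrderWeight
open scoped Nat

variable {V : Type*} [Fintype V] [DecidableEq V] {P : Finset (Equiv.Perm V)} {N : V → Finset V}

/-- The expected loss at `u` in a random order, times the size of `P`. -/
def meanLoss (P : Finset (Equiv.Perm V)) (N : V → Finset V) (u : V) : ℝ :=
  ∑ S ∈ (univ.erase u).powerset, wt S * loss P N u S

theorem notMem_of_mem_powerset_erase {u : V} {S : Finset V}
    (hS : S ∈ (univ.erase u : Finset V).powerset) : u ∉ S := fun h => by
  simpa using mem_powerset.1 hS h

theorem meanLoss_nonneg (hP : ∀ σ ∈ P, ∀ v, σ v ∈ N v) (u : V) : 0 ≤ meanLoss P N u :=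
  sum_nonneg fun S hS =>
    mul_nonneg (wt_pos S).le (loss_nonneg hP (notMem_of_mem_powerset_erase hS))

theorem sum_log_succ (d : ℕ) : ∑ i ∈ range d, Real.log ((i + 1 : ℕ) : ℝ) = Real.log d ! := by
  rw [← prod_range_add_one_eq_factorial, Nat.cast_prod, Real.log_prod]
  intro i _
  positivity

/-- The total entropy log |P| telescopes along a random order. The number of values available at `u`
is the number of elements of σ⁻¹(N u) not yet revealed; this set has size `d` and contains `u`, so
the count is uniform on 1, ..., d and its mean logarithm is (log d!) / d. -/
theorem card_mul_log_card [Nonempty V] (hP : ∀ σ ∈ P, ∀ v, σ v ∈ N v) {d : ℕ}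
    (hN : ∀ v, #(N v) = d) :
    #P * Real.log #P =
      #P * (Fintype.card V * (Real.log d ! / d)) - ∑ u, meanLoss P N u := by
  let F : Finset V → ℝ := fun S => -∑ σ ∈ P, Real.log #(cyl P S σ)
  have hF0 : F ∅ = -(#P * Real.log #P) := by
    simp [F, cyl]
  have hF1 : F univ = 0 := by
    have : ∀ σ ∈ P, Real.log #(cyl P univ σ) = 0 := by
      intro σ hσ
      have : cyl P univ σ = {σ} := by
        ext τ
        simp only [mem_cyl, mem_univ, true_imp_iff, mem_singleton]
        exact ⟨fun h => Equiv.ext h.2, fun h => ⟨h ▸ hσ, fun x => h ▸ rfl⟩⟩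
      simp [this]
    simp only [F]
    rw [sum_congr rfl this]
    simp
  have hinc : ∀ u S, F (insert u S) - F S =
      ∑ σ ∈ P, Real.log #(avail (N u) S σ) - loss P N u S := by
    intro u S
    simp only [F, loss, sum_add_distrib, sum_sub_distrib]
    ring
  have hrank : ∀ u, ∑ S ∈ (univ.erase u).powerset,
      wt S * ∑ σ ∈ P, Real.log #(avail (N u) S σ) = #P * (Real.log d ! / d) := by
    intro u
    simp_rw [mul_sum]
    rw [sum_comm]
    rw [← nsmul_eq_mul, ← sum_const]
    refine sum_congr rfl fun σ hσ => ?_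
    have hu : u ∈ (N u).image σ.symm := mem_image.2 ⟨σ u, hP σ hσ u, by simp⟩
    have h := sum_wt_card_sdiff _ hu fun k => Real.log (k : ℝ)
    rw [card_image_of_injective _ σ.symm.injective, hN, sum_log_succ] at h
    rw [← h]
    exact sum_congr rfl fun S _ => by rw [card_avail]
  have key := sum_wt_increment F
  rw [hF0, hF1] at key
  simp_rw [hinc, mul_sub, sum_sub_distrib, hrank] at key
  rw [sum_const, card_univ, nsmul_eq_mul] at key
  simp only [meanLoss]
  linarith

theorem meanLoss_eq {u v : V} (huv : u ≠ v) :
    meanLoss P N u = ∑ S ∈ ((univ.erase u).erase v).powerset,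
      (wt S * loss P N u S + wt (insert v S) * loss P N u (insert v S)) := by
  have hv : v ∈ (univ.erase u : Finset V) := by simp [huv.symm]
  rw [meanLoss]
  conv_lhs => rw [← insert_erase hv]
  rw [sum_powerset_insert (by simp), sum_add_distrib]

/-- Pairing `S` with `insert u S` and `insert v S` makes the four losses of `le_loss_pair` appear,
each with weight at least `wtMin S`. The good sets `S` have total weight at least 1/20, and (1/20) ·
1/(4 d⁶) = 1/(80 d⁶). -/
theorem le_meanLoss_pair (hP : ∀ σ ∈ P, ∀ v, σ v ∈ N v) {d : ℕ} (hN : ∀ v, #(N v) ≤ d) {u v : V}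
    {w w' : V} (hwu : w ∈ N u) (hwv : w ∈ N v) (hwu' : w' ∈ N u) (hwv' : w' ∉ N v) :
    #P * (1 / (80 * d ^ 6) : ℝ) ≤ meanLoss P N u + meanLoss P N v := by
  have huv : u ≠ v := fun h => hwv' (h ▸ hwu')
  let R : Finset V := (univ.erase u).erase v
  have hR : ∀ S ∈ R.powerset, u ∉ S ∧ v ∉ S := fun S hS =>
    ⟨fun h => by simpa [R] using mem_powerset.1 hS h,
      fun h => by simpa [R] using mem_powerset.1 hS h⟩
  let good : Finset V → Equiv.Perm V → Prop := fun S σ => w ∉ S.image σ ∧ w' ∉ S.image σ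
  have h1 : (#P : ℝ) * (1 / 20) ≤ ∑ S ∈ R.powerset, wtMin S * #(P.filter (good S)) := by
    have : ∑ S ∈ R.powerset, wtMin S * #(P.filter (good S)) =
        ∑ σ ∈ P, ∑ S ∈ R.powerset.filter (fun S => good S σ), wtMin S := by
      simp_rw [sum_filter]
      rw [sum_comm]
      refine sum_congr rfl fun S _ => ?_
      rw [← sum_filter, sum_const, nsmul_eq_mul, mul_comm]
    rw [this, ← nsmul_eq_mul, ← sum_const]
    refine sum_le_sum fun σ _ => ?_
    -- A set `S` avoiding these at most four vertices reveals neither `u` nor `v` and uses neither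
    -- `w` nor `w'`.
    let Z : Finset V := {u, v, σ.symm w, σ.symm w'}
    refine (le_sum_wtMin Z ⟨u, by simp [Z]⟩ card_le_four).trans
      (sum_le_sum_of_subset_of_nonneg ?_ fun _ _ _ => wtMin_nonneg _)
    intro S hS
    have hZ : ∀ x ∈ S, x ∉ Z := fun x hx => mem_compl.1 (mem_powerset.1 hS hx)
    simp only [Z, mem_insert, mem_singleton, not_or] at hZ
    rw [mem_filter, mem_powerset]
    refine ⟨fun x hx => ?_, fun h => ?_, fun h => ?_⟩
    · simp [R, (hZ x hx).1, (hZ x hx).2.1]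
    · obtain ⟨x, hx, rfl⟩ := mem_image.1 h
      exact (hZ x hx).2.2.1 (σ.symm_apply_apply x).symm
    · obtain ⟨x, hx, rfl⟩ := mem_image.1 h
      exact (hZ x hx).2.2.2 (σ.symm_apply_apply x).symm
  have h2 : (∑ S ∈ R.powerset, wtMin S * #(P.filter (good S))) * (1 / (4 * d ^ 6) : ℝ) ≤
      meanLoss P N u + meanLoss P N v := by
    rw [meanLoss_eq huv, meanLoss_eq huv.symm, erase_right_comm (a := v), ← sum_add_distrib,
      sum_mul]
    refine sum_le_sum fun S hS => ?_
    obtain ⟨hu, hv⟩ := hR S hS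
    have hloss := le_loss_pair hP hN huv hu hv hwu hwv hwu' hwv'
    have l1 := loss_nonneg hP (u := u) hu
    have l2 := loss_nonneg hP (u := v) hv
    have l3 := loss_nonneg hP (u := u) (S := insert v S) (by simp [hu, huv])
    have l4 := loss_nonneg hP (u := v) (S := insert u S) (by simp [hv, huv.symm])
    have m1 := mul_le_mul_of_nonneg_right (wtMin_le S) l1
    have m2 := mul_le_mul_of_nonneg_right (wtMin_le S) l2
    have m3 := mul_le_mul_of_nonneg_right (wtMin_le_insert huv.symm hv hu) l3
    have m4 := mul_le_mul_of_nonneg_right (wtMin_le_insert huv hu hv) l4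
    have := mul_le_mul_of_nonneg_left hloss (wtMin_nonneg S)
    rw [mul_assoc]
    refine this.trans ?_
    linarith
  refine le_trans (le_of_eq ?_) ((mul_le_mul_of_nonneg_right h1
    (by positivity : (0 : ℝ) ≤ 1 / (4 * d ^ 6))).trans h2)
  ring

end PermEntropy

/-! ### Stability of Brègman's bound for regular graphs -/

namespace SimpleGraph
open Finset
open scoped Nat

variable {V : Type*} [Fintype V]

/-- Vertices with a common neighbour with some vertex that has a different neighbourhood. -/
def IsDefect (G : SimpleGraph V) (v : V) : Prop :=
  ∃ u w, G.Adj u w ∧ G.Adj v w ∧ G.neighborSet u ≠ G.neighborSet v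

theorem IsRegularOfDegree.sum_sum_neighborFinset {G : SimpleGraph V} [DecidableRel G.Adj] {d : ℕ}
    (hG : G.IsRegularOfDegree d) (f : V → ℝ) :
    ∑ v, ∑ w ∈ G.neighborFinset v, f w = d * ∑ w, f w := by
  rw [sum_comm' (t' := univ) (s' := fun w => G.neighborFinset w)
    (by simp [G.adj_comm]), mul_sum]
  refine sum_congr rfl fun w _ => ?_
  rw [sum_const, card_neighborFinset_eq_degree, hG.degree_eq, nsmul_eq_mul]

open Classical in
/-- A stability version of Brègman's bound for the adjacency matrix of a regular graph. -/
theorem IsRegularOfDegree.log_card_perm_le [Nonempty V] {G : SimpleGraph V}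
    [DecidableRel G.Adj] {d : ℕ} (hG : G.IsRegularOfDegree d)
    (hpos : 0 < Nat.card {σ : Equiv.Perm V // ∀ v, G.Adj v (σ v)}) :
    Real.log (Nat.card {σ : Equiv.Perm V // ∀ v, G.Adj v (σ v)}) ≤
      Fintype.card V * (Real.log d ! / d) -
        (80 * d ^ 6 * (1 + d ^ 2) : ℝ)⁻¹ * #{v | G.IsDefect v} := by
  let P : Finset (Equiv.Perm V) := {σ | ∀ v, G.Adj v (σ v)}
  let N : V → Finset V := fun v => G.neighborFinset v
  have hcard : Nat.card {σ : Equiv.Perm V // ∀ v, G.Adj v (σ v)} = #P := by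
    rw [Nat.card_eq_fintype_card, Fintype.card_subtype]
  rw [hcard] at hpos ⊢
  have hP : ∀ σ ∈ P, ∀ v, σ v ∈ N v := fun σ hσ v => by
    simpa [N] using (mem_filter.1 hσ).2 v
  have hN : ∀ v, #(N v) = d := fun v => by
    rw [← hG.degree_eq v, ← card_neighborFinset_eq_degree]
  set L := PermEntropy.meanLoss P N with hL
  have hL0 : ∀ v, 0 ≤ L v := PermEntropy.meanLoss_nonneg hP
  have hmain := PermEntropy.card_mul_log_card hP hN
  -- The partner `u` of a defect `v` is two steps away through `w`. As losses are nonnegative, `L u`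
  -- may be replaced by the sum over all two-step walks from `v`; summed over `v`, this counts each
  -- loss d² times, whence the factor 1 + d².
  have hpair : ∀ v ∈ ({v | G.IsDefect v} : Finset V), #P * (1 / (80 * d ^ 6) : ℝ) ≤
      L v + ∑ w ∈ G.neighborFinset v, ∑ u ∈ G.neighborFinset w, L u := by
    intro v hv
    obtain ⟨u, w, huw, hvw, hne⟩ := (mem_filter.1 hv).2
    have hne' : N u ≠ N v := fun h => hne (by
      have := congrArg (fun s : Finset V => (s : Set V)) h
      simpa [N] using this)
    -- Regularity matters here: distinct neighbourhoods of equal size are not nested, which supplies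
    -- `w'`.
    have hsub : ¬ N u ⊆ N v := fun h => hne' (eq_of_subset_of_card_le h (by rw [hN, hN]))
    obtain ⟨w', hw', hw''⟩ := not_subset.1 hsub
    have h1 := PermEntropy.le_meanLoss_pair hP (fun v => (hN v).le) (u := u) (v := v) (w := w)
      (by simpa [N] using huw) (by simpa [N] using hvw) hw' hw''
    have h2 : L u ≤ ∑ x ∈ G.neighborFinset w, L x :=
      single_le_sum (fun x _ => hL0 x) (by simpa using huw.symm)
    have h3 : ∑ x ∈ G.neighborFinset w, L x ≤
        ∑ w ∈ G.neighborFinset v, ∑ u ∈ G.neighborFinset w, L u :=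
      single_le_sum (f := fun w => ∑ u ∈ G.neighborFinset w, L u)
        (fun x _ => sum_nonneg fun y _ => hL0 y) (by simpa using hvw)
    linarith
  have hsum : #{v | G.IsDefect v} * (#P * (1 / (80 * d ^ 6) : ℝ)) ≤
      (1 + d ^ 2) * ∑ v, L v := by
    rw [← nsmul_eq_mul, ← sum_const]
    refine (sum_le_sum hpair).trans ((sum_le_sum_of_subset_of_nonneg (subset_univ _)
      fun v _ _ => ?_).trans (le_of_eq ?_))
    · exact add_nonneg (hL0 v) (sum_nonneg fun _ _ => sum_nonneg fun _ _ => hL0 _)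
    · rw [sum_add_distrib, hG.sum_sum_neighborFinset, hG.sum_sum_neighborFinset]
      ring
  have hP0 : (0 : ℝ) < #P := Nat.cast_pos.2 hpos
  have hd0 : (0 : ℝ) < 1 + d ^ 2 := by positivity
  have hfin : (#P : ℝ) * ((80 * d ^ 6 * (1 + d ^ 2) : ℝ)⁻¹ * #{v | G.IsDefect v}) ≤ ∑ v, L v := by
    rw [← mul_le_mul_iff_right₀ hd0]
    refine le_trans (le_of_eq ?_) hsum
    rw [mul_inv]
    field_simp
  refine le_of_mul_le_mul_left ?_ hP0
  rw [hmain, mul_sub]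
  linarith

end SimpleGraph

/-! ### Sampling distance and the density of defects -/

namespace SamplingDistance
open SimpleGraph Finset

variable {V W : Type*}

theorem exists_walk_length_le_of_edist_le {G : SimpleGraph V} {v w : V} {r : ℕ}
    (h : G.edist v w ≤ r) : ∃ p : G.Walk v w, p.length ≤ r := by
  obtain ⟨p, hp⟩ := exists_walk_of_edist_ne_top (ne_top_of_le_ne_top (ENat.natCast_ne_top r) h)
  exact ⟨p, by rw [← hp] at h; exact_mod_cast h⟩

/-- The image is closed under adjacency, so a walk starting in it never leaves and lifts edge by
edge. -/
theorem exists_walk_of_embedding {K : SimpleGraph W} {G : SimpleGraph V} (f : K ↪g G)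
    (hf : ∀ x w, G.Adj (f x) w → ∃ y, f y = w) {v w : V} (p : G.Walk v w) :
    ∀ x, f x = v → ∃ y, f y = w ∧ ∃ q : K.Walk x y, q.length = p.length := by
  induction p with
  | nil => exact fun x hx => ⟨x, hx, .nil, rfl⟩
  | cons h p ih =>
    rintro x rfl
    obtain ⟨z, rfl⟩ := hf x _ h
    obtain ⟨y, hy, q, hq⟩ := ih z rfl
    exact ⟨y, hy, .cons (f.map_adj_iff.1 h) q, by simp [hq]⟩

theorem mem_closedBall_embedding {K : SimpleGraph W} {G : SimpleGraph V} (f : K ↪g G)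
    (hf : ∀ x w, G.Adj (f x) w → ∃ y, f y = w) (r : ℕ) (x : W) (v : V) :
    v ∈ closedBall G r (f x) ↔ ∃ y ∈ closedBall K r x, f y = v := by
  constructor
  · intro h
    obtain ⟨p, hp⟩ := exists_walk_length_le_of_edist_le h
    obtain ⟨y, hy, q, hq⟩ := exists_walk_of_embedding f hf p x rfl
    refine ⟨y, (Walk.edist_le q).trans ?_, hy⟩
    rw [hq]
    exact_mod_cast hp
  · rintro ⟨y, hy, rfl⟩
    obtain ⟨p, hp⟩ := exists_walk_length_le_of_edist_le hy
    refine (Walk.edist_le (p.map f.toHom)).trans ?_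
    rw [Walk.length_map]
    exact_mod_cast hp

/-- An embedding onto a union of components preserves balls. -/
theorem ballClass_embedding [Finite V] [Finite W] {K : SimpleGraph W} {G : SimpleGraph V}
    (f : K ↪g G) (hf : ∀ x w, G.Adj (f x) w → ∃ y, f y = w) (r : ℕ) (x : W) :
    ballClass K r x = ballClass G r (f x) := by
  rw [ballClass, ballClass, rootedClass_eq_iff]
  let g : closedBall K r x → closedBall G r (f x) := fun y =>
    ⟨f y, (mem_closedBall_embedding f hf r x _).2 ⟨y, y.2, rfl⟩⟩
  have hg : Function.Bijective g := by
    constructor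
    · intro y z h
      exact Subtype.ext (f.injective (congrArg Subtype.val h))
    · rintro ⟨v, hv⟩
      obtain ⟨y, hy, rfl⟩ := (mem_closedBall_embedding f hf r x _).1 hv
      exact ⟨⟨y, hy⟩, rfl⟩
  exact ⟨⟨Equiv.ofBijective g hg, f.map_adj_iff⟩, rfl⟩

theorem exists_equiv_apply_eq {A : Finset V} {d : ℕ} (hA : #A = d) (i : Fin d) {v : V}
    (hv : v ∈ A) : ∃ e : Fin d ≃ A, (e i : V) = v := by
  classical
  let e : Fin d ≃ A := (A.equivFinOfCardEq hA).symm
  exact ⟨e.trans (Equiv.swap (e i) ⟨v, hv⟩), by simp⟩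

/-- Two classes of vertices that are each other's neighbourhoods span a complete bipartite
component. -/
theorem exists_embedding_of_neighborSet_eq {G : SimpleGraph V} {d : ℕ} {A B : Finset V}
    (hA : ∀ a ∈ A, G.neighborSet a = B) (hB : ∀ b ∈ B, G.neighborSet b = A)
    (e : Fin d ≃ A) (e' : Fin d ≃ B) :
    ∃ f : completeBipartiteGraph (Fin d) (Fin d) ↪g G,
      (∀ x w, G.Adj (f x) w → ∃ y, f y = w) ∧ (∀ i, f (.inl i) = e i) ∧
        ∀ i, f (.inr i) = e' i := by
  have hA' : ∀ a ∈ A, ∀ w, G.Adj a w ↔ w ∈ B := fun a ha w => by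
    rw [← mem_neighborSet, hA a ha, mem_coe]
  have hB' : ∀ b ∈ B, ∀ w, G.Adj b w ↔ w ∈ A := fun b hb w => by
    rw [← mem_neighborSet, hB b hb, mem_coe]
  have hdisj : ∀ x ∈ A, x ∉ B := fun x hx hx' => G.irrefl ((hA' x hx x).2 hx')
  let g : Fin d ⊕ Fin d → V := Sum.elim (fun i => e i) (fun i => e' i)
  have hinj : Function.Injective g := by
    rintro (i | i) (j | j) h
    · exact congrArg _ (e.injective (Subtype.ext h))
    · have h' : (e i : V) = e' j := h
      exact absurd (h' ▸ (e' j).2) (hdisj _ (e i).2)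
    · have h' : (e' i : V) = e j := h
      exact absurd (h' ▸ (e' i).2) (hdisj _ (e j).2)
    · exact congrArg _ (e'.injective (Subtype.ext h))
  refine ⟨⟨⟨g, hinj⟩, ?_⟩, ?_, fun _ => rfl, fun _ => rfl⟩
  · rintro (i | i) (j | j)
    · simpa [g, hA' _ (e i).2] using hdisj _ (e j).2
    · simp [g, hA' _ (e i).2]
    · simp [g, hB' _ (e' i).2]
    · simpa [g, hB' _ (e' i).2] using fun h => hdisj _ h (e' j).2
  · rintro (i | i) w h
    · have hw : w ∈ B := (hA' _ (e i).2 w).1 h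
      exact ⟨.inr (e'.symm ⟨w, hw⟩), by simp [g]⟩
    · have hw : w ∈ A := (hB' _ (e' i).2 w).1 h
      exact ⟨.inl (e.symm ⟨w, hw⟩), by simp [g]⟩

/-- The balls around a vertex that is not a defect are those of the complete bipartite graph. -/
theorem ballClass_eq_of_not_isDefect [Fintype V] {G : SimpleGraph V} [DecidableRel G.Adj] {d : ℕ}
    [NeZero d] (hG : G.IsRegularOfDegree d) {v : V} (hv : ¬ G.IsDefect v) (r : ℕ)
    (x : Fin d ⊕ Fin d) :
    ballClass (completeBipartiteGraph (Fin d) (Fin d)) r x = ballClass G r v := by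
  have hcard : ∀ u, #(G.neighborFinset u) = d := fun u => by
    rw [card_neighborFinset_eq_degree, hG.degree_eq]
  have hv' : ∀ u w, G.Adj u w → G.Adj v w → G.neighborSet u = G.neighborSet v := by
    intro u w hu hw
    by_contra hne
    exact hv ⟨u, w, hu, hw, hne⟩
  obtain ⟨b, hb⟩ : (G.neighborFinset v).Nonempty :=
    card_pos.1 (by rw [hcard]; exact Nat.pos_of_ne_zero (NeZero.ne d))
  rw [mem_neighborFinset] at hb
  -- Every neighbour `a` of `b` shares `b` with `v`, so the absence of a defect forces N(a) = N(v).
  -- Then N(b) ⊆ N(w) for each w in N(v), with equality by regularity: N(b) and N(v) span a K_{d,d}.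
  have hA : ∀ a ∈ G.neighborFinset b, G.neighborSet a = G.neighborFinset v := by
    intro a ha
    rw [mem_neighborFinset] at ha
    rw [hv' a b ha.symm hb, coe_neighborFinset]
  have hB : ∀ w ∈ G.neighborFinset v, G.neighborSet w = G.neighborFinset b := by
    intro w hw
    have hsub : G.neighborFinset b ⊆ G.neighborFinset w := by
      intro a ha
      have : w ∈ G.neighborSet a := by rw [hA a ha]; exact hw
      rw [mem_neighborFinset]
      exact (G.mem_neighborSet a w).1 this |>.symm
    rw [eq_of_subset_of_card_le hsub (by rw [hcard, hcard]), coe_neighborFinset]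
  have hvA : v ∈ G.neighborFinset b := by simpa using hb.symm
  -- The side containing `x` is mapped onto N(b), with `x` sent to `v`.
  rcases x with i | i
  · obtain ⟨e, he⟩ := exists_equiv_apply_eq (hcard b) i hvA
    obtain ⟨f, hf, hl, -⟩ := exists_embedding_of_neighborSet_eq hA hB e
      (equivFinOfCardEq (hcard v)).symm
    rw [ballClass_embedding f hf, hl, he]
  · obtain ⟨e, he⟩ := exists_equiv_apply_eq (hcard b) i hvA
    obtain ⟨f, hf, -, hr⟩ := exists_embedding_of_neighborSet_eq hB hA
      (equivFinOfCardEq (hcard v)).symm e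
    rw [ballClass_embedding f hf, hr, he]

theorem tvDist_le_one {α : Type*} (p q : PMF α) : tvDist p q ≤ 1 :=
  ciSup_le fun A => abs_prob_sub_le_one p q A

-- An event containing `a` misses only vertices with f v ≠ a, and an event not containing `a`
-- catches only such vertices.
open Classical in
theorem tvDist_map_uniform_pure_le {α : Type*} [Fintype V] [Nonempty V] (f : V → α) (a : α) :
    tvDist ((PMF.uniformOfFintype V).map f) (PMF.pure a) ≤
      #{v | f v ≠ a} / Fintype.card V := by
  have hn : (0 : ℝ) < Fintype.card V := Nat.cast_pos.2 Fintype.card_pos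
  refine ciSup_le fun A => ?_
  have hp : (((PMF.uniformOfFintype V).map f).toOuterMeasure A).toReal =
      #{v | f v ∈ A} / Fintype.card V := by
    rw [PMF.toOuterMeasure_map_apply, PMF.toOuterMeasure_uniformOfFintype_apply,
      ENNReal.toReal_div, ENNReal.toReal_natCast, ENNReal.toReal_natCast, Fintype.card_subtype]
    rfl
  rw [hp, PMF.toOuterMeasure_pure_apply]
  split_ifs with ha
  · have hsplit := card_filter_add_card_filter_not (s := (univ : Finset V)) (fun v => f v ∈ A)
    rw [card_univ] at hsplit
    have hle : #{v | f v ∉ A} ≤ #{v | f v ≠ a} :=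
      card_le_card (monotone_filter_right _ fun v _ hv h => hv (h ▸ ha))
    have h1 : (#{v | f v ∈ A} : ℝ) + #{v | f v ∉ A} = Fintype.card V := by exact_mod_cast hsplit
    have h2 : (#{v | f v ∉ A} : ℝ) ≤ #{v | f v ≠ a} := by exact_mod_cast hle
    rw [ENNReal.toReal_one, div_sub_one hn.ne', abs_div, abs_of_pos hn, ← h1]
    gcongr
    rw [sub_add_cancel_left, abs_neg, abs_of_nonneg (Nat.cast_nonneg _)]
    exact h2
  · rw [ENNReal.toReal_zero, sub_zero, abs_of_nonneg (by positivity)]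
    gcongr
    rintro h rfl
    exact ha h

open Classical in
/-- The sampling distance to the complete bipartite graph is at most the density of defects. -/
theorem samplingDist_le [Fintype V] [Nonempty V] {G : SimpleGraph V} [DecidableRel G.Adj] {d : ℕ}
    [NeZero d] (hG : G.IsRegularOfDegree d) :
    samplingDist G (completeBipartiteGraph (Fin d) (Fin d)) ≤
      #{v | G.IsDefect v} / Fintype.card V := by
  have hn : (0 : ℝ) < Fintype.card V := Nat.cast_pos.2 Fintype.card_pos
  set δ : ℝ := #{v | G.IsDefect v} / Fintype.card V with hδ
  have htv : ∀ r, tvDist (ballLaw G r)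
      (ballLaw (completeBipartiteGraph (Fin d) (Fin d)) r) ≤ δ := by
    intro r
    -- If all vertices are defects the bound is 1. Otherwise any non-defect `v` supplies the one
    -- ball class on which the law of K_{d,d} is concentrated.
    by_cases hall : ∀ v, G.IsDefect v
    · refine (tvDist_le_one _ _).trans (le_of_eq ?_)
      rw [hδ, filter_true_of_mem fun v _ => hall v, card_univ, div_self hn.ne']
    · obtain ⟨v, hv⟩ := not_forall.1 hall
      have hK : ballLaw (completeBipartiteGraph (Fin d) (Fin d)) r =
          PMF.pure (ballClass G r v) := by
        rw [ballLaw, show ballClass (completeBipartiteGraph (Fin d) (Fin d)) r =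
          Function.const _ (ballClass G r v) from
            funext fun x => ballClass_eq_of_not_isDefect hG hv r x, PMF.map_const]
      rw [hK, ballLaw]
      refine (tvDist_map_uniform_pure_le _ _).trans ?_
      rw [hδ]
      gcongr with u
      intro hu
      by_contra hu'
      exact hu ((ballClass_eq_of_not_isDefect hG hu' r (.inl 0)).symm.trans
        (ballClass_eq_of_not_isDefect hG hv r (.inl 0)))
  have hgeom : HasSum (fun r : ℕ => (1 / 2 : ℝ) ^ (r + 1) * δ) δ := by
    have h := (hasSum_geometric_two.mul_left (1 / 2)).mul_right δ
    have e : (1 / 2 * 2 : ℝ) * δ = δ := by ring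
    rw [e] at h
    exact h.congr_fun fun r => by ring
  rw [samplingDist, ← hgeom.tsum_eq]
  exact (summable_samplingDist G _).tsum_le_tsum
    (fun r => mul_le_mul_of_nonneg_left (htv _) (by positivity)) hgeom.summable

end SamplingDistance

/-! ### Perfect matchings of the complete bipartite graph -/

namespace SimpleGraph
open scoped Nat

/-- The perfect matching of the complete bipartite graph given by a bijection. -/
def bijectionMatching {α β : Type*} (e : α ≃ β) : (completeBipartiteGraph α β).Subgraph where
  verts := Set.univ
  Adj x y := (∃ i, x = .inl i ∧ y = .inr (e i)) ∨ ∃ i, x = .inr (e i) ∧ y = .inl i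
  adj_sub := by
    rintro _ _ (⟨i, rfl, rfl⟩ | ⟨i, rfl, rfl⟩) <;> simp
  edge_vert _ := Set.mem_univ _
  symm := ⟨by
    rintro _ _ (⟨i, rfl, rfl⟩ | ⟨i, rfl, rfl⟩)
    · exact Or.inr ⟨i, rfl, rfl⟩
    · exact Or.inl ⟨i, rfl, rfl⟩⟩

theorem isPerfectMatching_bijectionMatching {α β : Type*} (e : α ≃ β) :
    (bijectionMatching e).IsPerfectMatching := by
  rw [Subgraph.isPerfectMatching_iff]
  rintro (i | i)
  · exact ⟨.inr (e i), Or.inl ⟨i, rfl, rfl⟩, by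
      rintro _ (⟨j, hj, rfl⟩ | ⟨j, hj, -⟩)
      · rw [Sum.inl.inj hj]
      · cases hj⟩
  · refine ⟨.inl (e.symm i), Or.inr ⟨e.symm i, by simp, rfl⟩, ?_⟩
    rintro _ (⟨j, hj, -⟩ | ⟨j, hj, rfl⟩)
    · cases hj
    · rw [Sum.inr.inj hj, e.symm_apply_apply]

/-- This direction suffices, since the count for K_{d,d} enters only in the upper bound. -/
theorem factorial_le_numPerfectMatchings (d : ℕ) :
    d ! ≤ numPerfectMatchings (completeBipartiteGraph (Fin d) (Fin d)) := by
  have : Nat.card (Equiv.Perm (Fin d)) = d ! := by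
    rw [Nat.card_perm, Nat.card_fin]
  rw [← this, numPerfectMatchings]
  refine Nat.card_le_card_of_injective (fun e =>
    (⟨bijectionMatching e, isPerfectMatching_bijectionMatching e⟩ :
      {M : (completeBipartiteGraph (Fin d) (Fin d)).Subgraph // M.IsPerfectMatching})) ?_
  intro e e' h
  ext i
  have h1 : (bijectionMatching e).Adj (.inl i) (.inr (e i)) := Or.inl ⟨i, rfl, rfl⟩
  have h2 : bijectionMatching e = bijectionMatching e' := congrArg Subtype.val h
  rw [h2] at h1
  obtain ⟨j, hj, hj'⟩ | ⟨j, hj, -⟩ := h1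
  · rw [Sum.inr.inj hj', Sum.inl.inj hj]
  · cases hj

end SimpleGraph

theorem ENNReal.log_natCast {m : ℕ} (hm : 0 < m) :
    ENNReal.log (m : ℝ≥0∞) = ((Real.log m : ℝ) : EReal) := by
  rw [← ENNReal.ofReal_natCast, ENNReal.log_ofReal_of_pos (Nat.cast_pos.2 hm)]

end

/-! ### Assembly of the estimate -/

theorem corollary10 (d : ℕ) [NeZero d] :
    ∃ c : ℝ, 0 < c ∧
      ∀ (V : Type*) [Fintype V] [Nonempty V] (G : SimpleGraph V) [DecidableRel G.Adj],
        G.IsRegularOfDegree d →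
          ((1 / (Fintype.card V : ℝ) : ℝ) : EReal) *
              ENNReal.log (numPerfectMatchings G : ℝ≥0∞) ≤
            ((1 / (2 * (d : ℝ)) : ℝ) : EReal) *
                ENNReal.log
                  (numPerfectMatchings (completeBipartiteGraph (Fin d) (Fin d)) : ℝ≥0∞) -
              ((c * SamplingDistance.samplingDist G
                (completeBipartiteGraph (Fin d) (Fin d)) : ℝ) : EReal) := by
  classical
  have hd : (0 : ℝ) < d := Nat.cast_pos.2 (Nat.pos_of_ne_zero (NeZero.ne d))
  -- The constant of `log_card_perm_le`, halved because the permutations bound the square of the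
  -- number of matchings.
  refine ⟨(80 * d ^ 6 * (1 + d ^ 2) : ℝ)⁻¹ / 2, by positivity, ?_⟩
  intro V _ _ G _ hG
  have hn : (0 : ℝ) < Fintype.card V := Nat.cast_pos.2 Fintype.card_pos
  obtain hm | hm := Nat.eq_zero_or_pos (numPerfectMatchings G)
  · rw [hm, Nat.cast_zero, ENNReal.log_zero, EReal.coe_mul_bot_of_pos (by positivity)]
    exact bot_le
  have hsq := SimpleGraph.sq_numPerfectMatchings_le G
  have hP := hG.log_card_perm_le ((pow_pos hm 2).trans_le hsq)
  have hδ := SamplingDistance.samplingDist_le hG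
  have hfac := SimpleGraph.factorial_le_numPerfectMatchings d
  have hK : 0 < numPerfectMatchings (completeBipartiteGraph (Fin d) (Fin d)) :=
    d.factorial_pos.trans_le hfac
  rw [ENNReal.log_natCast hm, ENNReal.log_natCast hK, ← EReal.coe_mul, ← EReal.coe_mul,
    ← EReal.coe_sub, EReal.coe_le_coe_iff]
  have h1 : 2 * Real.log (numPerfectMatchings G) ≤
      Real.log (Nat.card {σ : Equiv.Perm V // ∀ v, G.Adj v (σ v)}) := by
    rw [← Nat.cast_two, ← Real.log_pow]
    exact Real.log_le_log (by positivity) (by exact_mod_cast hsq)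
  have h2 : Real.log d.factorial ≤
      Real.log (numPerfectMatchings (completeBipartiteGraph (Fin d) (Fin d))) :=
    Real.log_le_log (Nat.cast_pos.2 d.factorial_pos) (by exact_mod_cast hfac)
  set c : ℝ := (80 * d ^ 6 * (1 + d ^ 2) : ℝ)⁻¹
  have hc : 0 ≤ c / 2 := by positivity
  have h3 := mul_le_mul_of_nonneg_left hδ hc
  refine le_trans ?_ (sub_le_sub (mul_le_mul_of_nonneg_left h2 (by positivity)) h3)
  have h4 := h1.trans hP
  rw [one_div, inv_mul_le_iff₀ hn]
  refine le_trans ((le_div_iff₀' (zero_lt_two' ℝ)).2 h4) (le_of_eq ?_)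
  field_simp
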